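/- Let $\mathbb{D}=\{z\in\mathbb{C}:|z|<1\}$ and $D(a,r)=\{z:|z-a|<r\}$. Let $\mathcal{H}$ be the class of complex-valued harmonic functions $f=h+\overline{g}$ in $\mathbb{D}$, where $h$ and $g$ are analytic in $\mathbb{D}$ with $h(0)=0$, $h'(0)=1$ and $g(0)=0$. Such an $f$ is called sense-preserving if its Jacobian $J_f=|f_z|^2-|f_{\overline z}|^2$ is positive in $\mathbb{D}$. Let $\mathcal{AK}_H$ (the absolutely convex functions) be the class of locally univalent $f\in\mathcal{H}$ such that $f(D(a,r))$ is convex for all $a\in\mathbb{D}$ and all $r\in(0,1-|a|)$, and let $\widetilde{\mathcal{AK}_H}$ be the class of those $f\in\mathcal{AK}_H$ such that $f(D(a,r))$ is convex for all $a\in\mathbb{D}$ and all $r\in(0,1-|a|]$. **Theorem.** Let $f=h+\overline{g}\in\mathcal{H}$ be sense-preserving in $\mathbb{D}$. Then the following statements are equivalent: (i) $f\in\mathcal{AK}_H$; (ii) $f\in\widetilde{\mathcal{AK}_H}$; (iii) for all $\zeta,b\in\mathbb{D}$, $$ \begin{aligned} &|h'(\zeta)|^2\left(1+|b|^2+\operatorname{Re}\left\{\frac{(\zeta-b)(1-\zeta\overline{b})h''(\zeta)}{h'(\zeta)}-2\overline{b}\zeta\right\}\right)\\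 &\quad\ge |g'(\zeta)|^2\left(1+|b|^2+\operatorname{Re}\left\{\frac{(\zeta-b)(1-\zeta\overline{b})g''(\zeta)}{g'(\zeta)}-2\overline{b}\zeta\right\}\right)\\ &\qquad+\operatorname{Re}\left\{\frac{(\zeta-b)^3(1-\zeta\overline{b})^3}{|\zeta-b|^2\,|1-\zeta\overline{b}|^2}\,\bigl[h''(\zeta)g'(\zeta)-h'(\zeta)g''(\zeta)\bigr]\right\}, \end{aligned} $$ where the first term on the right-hand side is read as $0$ if $g'(\zeta)=0$, and the last term as $0$ if $\zeta=b$. -/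

import Mathlib

open scoped ComplexConjugate

namespace HarmonicDisk

/-- The Wirtinger derivative `f_z = (f_x - i f_y) / 2`. -/
noncomputable def dz (f : ℂ → ℂ) (z : ℂ) : ℂ :=
  (fderiv ℝ f z 1 - Complex.I * fderiv ℝ f z Complex.I) / 2

/-- The Wirtinger derivative `f_{z̄} = (f_x + i f_y) / 2`. -/
noncomputable def dzbar (f : ℂ → ℂ) (z : ℂ) : ℂ :=
  (fderiv ℝ f z 1 + Complex.I * fderiv ℝ f z Complex.I) / 2

/-- The Jacobian `J_f = |f_z|² - |f_{z̄}|²`. -/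
noncomputable def jacobian (f : ℂ → ℂ) (z : ℂ) : ℝ :=
  ‖dz f z‖ ^ 2 - ‖dzbar f z‖ ^ 2

/-- `f` is sense-preserving in the open unit disk. -/
def SensePreserving (f : ℂ → ℂ) : Prop :=
  ∀ z ∈ Metric.ball (0 : ℂ) 1, 0 < jacobian f z

/-- `f` is locally univalent (locally injective) in the open unit disk. -/
def LocallyUnivalent (f : ℂ → ℂ) : Prop :=
  ∀ z ∈ Metric.ball (0 : ℂ) 1, ∃ U ∈ nhds z, Set.InjOn f U

/-- `f = h + conj g` in the open unit disk, where `h` and `g` are analytic there, with Taylor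
expansions `h(z) = z + a₂ z² + ⋯` and `g(z) = b₁ z + b₂ z² + ⋯`. The values of `f`, `h`, `g`
outside the open unit disk play no role. -/
structure IsDecomposition (f h g : ℂ → ℂ) : Prop where
  h_analytic : AnalyticOnNhd ℂ h (Metric.ball 0 1)
  g_analytic : AnalyticOnNhd ℂ g (Metric.ball 0 1)
  h_zero : h 0 = 0
  h_deriv_zero : deriv h 0 = 1
  g_zero : g 0 = 0
  eq_add_conj : ∀ z ∈ Metric.ball (0 : ℂ) 1, f z = h z + conj (g z)

/-- The class of normalized complex-valued harmonic functions in the open unit disk. -/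
def classH : Set (ℂ → ℂ) := {f | ∃ h g : ℂ → ℂ, IsDecomposition f h g}

/-- Absolutely convex harmonic functions: locally univalent members of the normalized class that
map every disk `D(a, r)`, `|a| < 1`, `0 < r < 1 - |a|`, onto a convex set. -/
def classAK : Set (ℂ → ℂ) :=
  {f | f ∈ classH ∧ LocallyUnivalent f ∧
    ∀ a ∈ Metric.ball (0 : ℂ) 1, ∀ r ∈ Set.Ioo (0 : ℝ) (1 - ‖a‖),
      Convex ℝ (f '' Metric.ball a r)}

/-- The absolutely convex functions whose disk property persists for `0 < r ≤ 1 - |a|`. -/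
def classAKTilde : Set (ℂ → ℂ) :=
  {f | f ∈ classAK ∧
    ∀ a ∈ Metric.ball (0 : ℂ) 1, ∀ r ∈ Set.Ioc (0 : ℝ) (1 - ‖a‖),
      Convex ℝ (f '' Metric.ball a r)}

end HarmonicDisk

/-!
At a point `ζ` where `f = h + conj g` has positive Jacobian, the sign of the curvature of the image
of a circle about `a` through `ζ` is the sign of `curvatureForm` at `e = ζ - a`. Apart from the
Jacobian this form is homogeneous of degree one in `e`. The circles in the unit disk are the
hyperbolic circles, and `sub_eq_curvatureForm` with `circleRatio_mul_sub` shows that the difference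
of the two sides of the inequality at `(ζ, b)` is a positive multiple of the form for the circle
through `ζ` with hyperbolic centre `b`. So the inequality says that the images of all circles in the
unit disk have nonnegative curvature; by homogeneity the curvature is then even positive
(`IsDecomposition.curvatureForm_pos`), because every circle lies inside a larger one that is tangent
to it at a prescribed point.

What remains is to compare curvature with convexity, and the main point is univalence.
`injOn_closedBall_of_convex_image` is a continuity argument in the radius: if `f` is injective on a
disk and the image is convex, then the inverse is Lipschitz on the image with a constant that depends
only on the derivative of `f`; this estimate survives on the closed disk, and so injectivity spreads
to a larger disk. Hence `f` is injective on every closed disk as soon as injectivity on a concentric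
disk implies convexity of its image.

If the images of disks are convex, a supporting line at `f ζ` makes a linear functional of `f`
maximal at the boundary point `ζ`, and the second derivative along the boundary circle gives the
inequality (`IsDecomposition.curvatureForm_nonneg_of_convex_image`). Conversely, suppose that the
curvature is positive and `f` is injective on the disk about `a`. Along the preimage of a segment in
the image, the distance from `a` has no interior maximum, so the preimage stays in the smallest
concentric closed disk that contains its end points; therefore, as one end point moves, the
condition that the segment lies in the image is open and closed (`convex_image_ball_of_segment`,
`IsDecomposition.convex_image_ball_of_curvatureForm_pos`). Finally, a disk tangent to the unit circle
is an increasing union of smaller disks, which gives the passage from `r < 1 - |a|` to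
`r ≤ 1 - |a|`.
-/

namespace HarmonicDisk

open Set Metric Filter Topology

/-! ### A second derivative test -/

theorem second_deriv_nonpos_of_isLocalMax {φ φ' : ℝ → ℝ} {t φ'' : ℝ} (hmax : IsLocalMax φ t)
    (h1 : ∀ᶠ s in 𝓝 t, HasDerivAt φ (φ' s) s) (h2 : HasDerivAt φ' φ'' t) : φ'' ≤ 0 := by
  by_contra! hpos
  have hd : deriv φ =ᶠ[𝓝 t] φ' := h1.mono fun s hs => hs.deriv
  have hdd : deriv (deriv φ) t = φ'' := by rw [hd.deriv_eq, h2.deriv]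
  have hmin : IsLocalMin φ t :=
    isLocalMin_of_deriv_deriv_pos (by rwa [hdd]) hmax.deriv_eq_zero h1.self_of_nhds.continuousAt
  have hconst : φ =ᶠ[𝓝 t] fun _ => φ t := by
    filter_upwards [hmax, hmin] with s hs hs' using le_antisymm hs hs'
  have : deriv φ =ᶠ[𝓝 t] fun _ => 0 := by
    simpa using hconst.deriv
  rw [this.deriv_eq, deriv_const] at hdd
  exact hpos.ne hdd

/-! ### Injectivity and convexity of the images of balls -/

section Balls

variable {E : Type*} [NormedAddCommGroup E] [NormedSpace ℝ E]

theorem isOpen_image_of_hasStrictFDerivAt_equiv [CompleteSpace E] {f : E → E} {U : Set E}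
    (hU : IsOpen U)
    (hL : ∀ z ∈ U, ∃ L : E ≃L[ℝ] E, HasStrictFDerivAt f (L : E →L[ℝ] E) z) :
    IsOpen (f '' U) := by
  rw [isOpen_iff_mem_nhds]
  rintro _ ⟨z, hz, rfl⟩
  obtain ⟨L, hfL⟩ := hL z hz
  rw [← hfL.map_nhds_eq_of_equiv]
  exact image_mem_map (hU.mem_nhds hz)

theorem exists_injOn_nhds_of_hasStrictFDerivAt_equiv [CompleteSpace E] {f : E → E} {z : E}
    {L : E ≃L[ℝ] E} (hL : HasStrictFDerivAt f (L : E →L[ℝ] E) z) : ∃ U ∈ 𝓝 z, InjOn f U :=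
  ⟨(hL.toOpenPartialHomeomorph f).source,
    (hL.toOpenPartialHomeomorph f).open_source.mem_nhds hL.mem_toOpenPartialHomeomorph_source,
    (hL.toOpenPartialHomeomorph f).injOn⟩

theorem le_norm_sub_of_convex_image [CompleteSpace E] {f : E → E} {U : Set E} (hU : IsOpen U)
    {c : ℝ} (hc : 0 < c)
    (hL : ∀ z ∈ U, ∃ L : E ≃L[ℝ] E, HasStrictFDerivAt f (L : E →L[ℝ] E) z ∧
      ∀ u, c * ‖u‖ ≤ ‖L u‖)
    (hinj : InjOn f U) (hconv : Convex ℝ (f '' U)) {z w : E} (hz : z ∈ U) (hw : w ∈ U) :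
    c * ‖z - w‖ ≤ ‖f z - f w‖ := by
  have hleft : ∀ x ∈ U, Function.invFunOn f U (f x) = x := fun x hx => hinj.leftInvOn_invFunOn hx
  choose! L hfL hLc using hL
  have hder : ∀ y ∈ f '' U, HasFDerivWithinAt (Function.invFunOn f U)
      ((L (Function.invFunOn f U y)).symm : E →L[ℝ] E) (f '' U) y := by
    rintro _ ⟨x, hx, rfl⟩
    rw [hleft x hx]
    exact ((hfL x hx).to_local_left_inverse
      (eventually_of_mem (hU.mem_nhds hx) hleft)).hasFDerivAt.hasFDerivWithinAt
  have hbound : ∀ y ∈ f '' U, ‖((L (Function.invFunOn f U y)).symm : E →L[ℝ] E)‖ ≤ c⁻¹ := by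
    rintro _ ⟨x, hx, rfl⟩
    rw [hleft x hx]
    refine ContinuousLinearMap.opNorm_le_bound _ (by positivity) fun v => ?_
    have := hLc x hx ((L x).symm v)
    rw [ContinuousLinearEquiv.apply_symm_apply] at this
    rw [inv_mul_eq_div, le_div_iff₀ hc]
    simpa [mul_comm] using this
  have := hconv.norm_image_sub_le_of_norm_hasFDerivWithin_le hder hbound
    (mem_image_of_mem f hw) (mem_image_of_mem f hz)
  rw [hleft z hz, hleft w hw, inv_mul_eq_div, le_div_iff₀ hc] at this
  linarith

/-- Continuity method in the radius: if `f` is a local diffeomorphism near the closed ball and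
the image of each concentric ball on which `f` is injective is convex, then `f` is injective on
the closed ball. On a convex image the inverse is Lipschitz with a constant that does not depend
on the ball; this bound passes to the closed ball, and injectivity on a compact set spreads to a
neighbourhood. -/
theorem injOn_closedBall_of_convex_image [ProperSpace E] {f : E → E} {a : E} {r c : ℝ}
    (hr : 0 ≤ r) (hc : 0 < c)
    (hL : ∀ z ∈ closedBall a r, ∃ L : E ≃L[ℝ] E, HasStrictFDerivAt f (L : E →L[ℝ] E) z ∧
      ∀ u, c * ‖u‖ ≤ ‖L u‖)
    (hconv : ∀ R ∈ Ioc 0 r, InjOn f (ball a R) → Convex ℝ (f '' ball a R)) :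
    InjOn f (closedBall a r) := by
  have hcont : ContinuousOn f (closedBall a r) := fun z hz => by
    obtain ⟨L, hfL, -⟩ := hL z hz
    exact hfL.continuousAt.continuousWithinAt
  let T : Set ℝ := {R | ∀ u ∈ closedBall (0 : E) 1, ∀ v ∈ closedBall (0 : E) 1,
    c * ‖(a + R • u) - (a + R • v)‖ ≤ ‖f (a + R • u) - f (a + R • v)‖}
  have hmem : ∀ {R : ℝ} {u : E}, 0 ≤ R → u ∈ closedBall (0 : E) 1 → a + R • u ∈ closedBall a R := by
    intro R u hR hu
    rw [mem_closedBall_zero_iff] at hu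
    rw [mem_closedBall_iff_norm, add_sub_cancel_left, norm_smul, Real.norm_of_nonneg hR]
    exact mul_le_of_le_one_right hR hu
  have hinj : ∀ R ∈ T, 0 ≤ R → InjOn f (closedBall a R) := by
    intro R hRT hR
    rcases hR.eq_or_lt with rfl | hR
    · simp
    have hpar : ∀ z ∈ closedBall a R, ∃ u ∈ closedBall (0 : E) 1, a + R • u = z := by
      intro z hz
      refine ⟨R⁻¹ • (z - a), ?_, by rw [smul_inv_smul₀ hR.ne']; abel⟩
      rw [mem_closedBall_iff_norm] at hz
      rw [mem_closedBall_zero_iff, norm_smul, norm_inv, Real.norm_of_nonneg hR.le,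
        inv_mul_le_one₀ hR]
      exact hz
    intro z hz w hw hzw
    obtain ⟨u, hu, rfl⟩ := hpar z hz
    obtain ⟨v, hv, rfl⟩ := hpar w hw
    have h := hRT u hu v hv
    rw [hzw, sub_self, norm_zero] at h
    rw [← sub_eq_zero, ← norm_le_zero_iff]
    exact nonpos_of_mul_nonpos_right h hc
  have hclosed : IsClosed (T ∩ Icc 0 r) := by
    have : T ∩ Icc 0 r = Icc 0 r ∩ ⋂ u ∈ closedBall (0 : E) 1, ⋂ v ∈ closedBall (0 : E) 1,
        {R ∈ Icc 0 r | c * ‖(a + R • u) - (a + R • v)‖ ≤ ‖f (a + R • u) - f (a + R • v)‖} := by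
      ext R
      simp only [T, mem_inter_iff, mem_ofPred_eq, mem_iInter]
      exact ⟨fun ⟨h, hR⟩ => ⟨hR, fun u hu v hv => ⟨hR, h u hu v hv⟩⟩,
        fun ⟨hR, h⟩ => ⟨fun u hu v hv => (h u hu v hv).2, hR⟩⟩
    rw [this]
    refine isClosed_Icc.inter (isClosed_biInter fun u hu => isClosed_biInter fun v hv => ?_)
    have hline : ∀ x ∈ closedBall (0 : E) 1,
        ContinuousOn (fun R : ℝ => f (a + R • x)) (Icc 0 r) := fun x hx =>
      hcont.comp (by fun_prop) fun R hR => closedBall_subset_closedBall hR.2 (hmem hR.1 hx)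
    exact isClosed_Icc.isClosed_le (by fun_prop) ((hline u hu).sub (hline v hv)).norm
  have hsub : Icc 0 r ⊆ T := by
    refine hclosed.Icc_subset_of_forall_exists_gt (by simp [T]) ?_
    rintro R ⟨hRT, hR0, hRr⟩ y hy
    have hKr : closedBall a R ⊆ closedBall a r := closedBall_subset_closedBall hRr.le
    obtain ⟨t, ht, htinj⟩ := (hinj R hRT hR0).exists_mem_nhdsSet (isCompact_closedBall a R)
      (fun x hx => by
        obtain ⟨L, hfL, -⟩ := hL x (hKr hx)
        exact hfL.continuousAt)
      (fun x hx => by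
        obtain ⟨L, hfL, -⟩ := hL x (hKr hx)
        exact exists_injOn_nhds_of_hasStrictFDerivAt_equiv hfL)
    obtain ⟨V, hV, hKV, hVt⟩ := mem_nhdsSet_iff_exists.mp ht
    obtain ⟨δ, hδ, hδV⟩ := (isCompact_closedBall a R).exists_thickening_subset_open hV hKV
    rw [thickening_closedBall hδ hR0] at hδV
    obtain ⟨R', hR', hR'lt⟩ : ∃ R', R < R' ∧ R' < min y (min r (δ + R)) :=
      exists_between (lt_min hy (lt_min hRr (by linarith)))
    simp only [lt_min_iff] at hR'lt
    let R₁ := min r (δ + R)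
    have hR₁ : R' < R₁ := lt_min hR'lt.2.1 hR'lt.2.2
    have hinj₁ : InjOn f (ball a R₁) :=
      htinj.mono (((ball_subset_ball (min_le_right _ _)).trans hδV).trans hVt)
    have hR₁pos : 0 < R₁ := by linarith
    refine ⟨R', fun u hu v hv => ?_, hR', hR'lt.1.le⟩
    have hball : closedBall a R' ⊆ ball a R₁ := closedBall_subset_ball hR₁
    exact le_norm_sub_of_convex_image isOpen_ball hc
      (fun z hz => hL z (ball_subset_closedBall (ball_subset_ball (min_le_left _ _) hz)))
      hinj₁ (hconv R₁ ⟨hR₁pos, min_le_left _ _⟩ hinj₁)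
      (hball (hmem (by linarith) hu)) (hball (hmem (by linarith) hv))
  exact hinj r (hsub ⟨hr, le_rfl⟩) hr

/-- A convexity criterion for the image of a ball. If every segment that stays inside the image
stays in the image of the smallest concentric closed ball that contains preimages of its two end
points, then the image is convex: if the second end point moves from `f z` to `f w` along the image
of the segment from `z` to `w`, the parameters with segment inside the image form an open and closed
set. -/
theorem convex_image_ball_of_segment [ProperSpace E] {f : E → E} {a : E} {R : ℝ}
    (hcont : ContinuousOn f (ball a R)) (hopen : IsOpen (f '' ball a R))
    (hseg : ∀ z ∈ ball a R, ∀ w ∈ ball a R, segment ℝ (f z) (f w) ⊆ f '' ball a R →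
      segment ℝ (f z) (f w) ⊆ f '' closedBall a (max (dist z a) (dist w a))) :
    Convex ℝ (f '' ball a R) := by
  rw [convex_iff_segment_subset]
  rintro _ ⟨z, hz, rfl⟩ _ ⟨w, hw, rfl⟩
  set ρ := max (dist z a) (dist w a) with hρ
  have hρR : ρ < R := max_lt hz hw
  have hKsub : closedBall a ρ ⊆ ball a R := closedBall_subset_ball hρR
  have hK : IsClosed (f '' closedBall a ρ) :=
    ((isCompact_closedBall a ρ).image_of_continuousOn (hcont.mono hKsub)).isClosed
  have hzK : z ∈ closedBall a ρ := mem_closedBall.mpr (le_max_left _ _)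
  have hwK : w ∈ closedBall a ρ := mem_closedBall.mpr (le_max_right _ _)
  let x : ℝ → E := fun t => AffineMap.lineMap z w t
  have hx : ∀ t ∈ Icc (0 : ℝ) 1, x t ∈ closedBall a ρ := fun t ht =>
    (convex_closedBall a ρ).lineMap_mem hzK hwK ht
  have hxc : Continuous x := by fun_prop
  have hfx : ContinuousOn (fun t => f (x t)) (Icc 0 1) :=
    hcont.comp hxc.continuousOn fun t ht => hKsub (hx t ht)
  let S : Set ℝ := {t | ∀ s ∈ Icc (0 : ℝ) 1,
    AffineMap.lineMap (f z) (f (x t)) s ∈ f '' closedBall a ρ}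
  have hSclosed : IsClosed (S ∩ Icc 0 1) := by
    have : S ∩ Icc 0 1 = Icc 0 1 ∩ ⋂ s ∈ Icc (0 : ℝ) 1, (Icc (0 : ℝ) 1 ∩
        (fun t => AffineMap.lineMap (f z) (f (x t)) s) ⁻¹' (f '' closedBall a ρ)) := by
      ext t
      simp only [S, mem_inter_iff, mem_ofPred_eq, mem_iInter, mem_preimage]
      exact ⟨fun ⟨h, ht⟩ => ⟨ht, fun s hs => ⟨ht, h s hs⟩⟩,
        fun ⟨ht, h⟩ => ⟨fun s hs => (h s hs).2, ht⟩⟩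
    rw [this]
    refine isClosed_Icc.inter (isClosed_biInter fun s hs => ?_)
    refine ContinuousOn.preimage_isClosed_of_isClosed ?_ isClosed_Icc hK
    simp only [AffineMap.lineMap_apply_module]
    exact continuousOn_const.add (hfx.const_smul s)
  have hsub : Icc (0 : ℝ) 1 ⊆ S := by
    refine hSclosed.Icc_subset_of_forall_exists_gt ?_ ?_
    · intro s hs
      simpa [x] using mem_image_of_mem f hzK
    · rintro t ⟨htS, ht0, ht1⟩ y hy
      -- Openness of the image and compactness of `[0, 1]` move the whole segment.
      have hev : ∀ᶠ t' in 𝓝[Icc 0 1] t, ∀ s ∈ Icc (0 : ℝ) 1,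
          AffineMap.lineMap (f z) (f (x t')) s ∈ f '' ball a R := by
        have hev' : ∀ᶠ q in 𝓝 (f (x t)), ∀ s ∈ Icc (0 : ℝ) 1,
            AffineMap.lineMap (f z) q s ∈ f '' ball a R := by
          refine isCompact_Icc.eventually_forall_of_forall_eventually fun s hs => ?_
          have hc : Continuous fun p : E × ℝ => AffineMap.lineMap (f z) p.1 p.2 := by
            simp only [AffineMap.lineMap_apply_module]
            fun_prop
          exact hc.continuousAt.eventually_mem
            (hopen.mem_nhds (image_mono hKsub (htS s hs)))
        exact (hfx t ⟨ht0, ht1.le⟩).eventually hev'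
      have hev2 : ∀ᶠ t' in 𝓝[>] t, t' ∈ Ioc t y ∧ t' ∈ Icc (0 : ℝ) 1 ∧ ∀ s ∈ Icc (0 : ℝ) 1,
          AffineMap.lineMap (f z) (f (x t')) s ∈ f '' ball a R := by
        have h1 : Ioc t (min y 1) ∈ 𝓝[>] t := Ioc_mem_nhdsGT (lt_min hy ht1)
        have h2 : 𝓝[Ioc t (min y 1)] t ≤ 𝓝[Icc 0 1] t := nhdsWithin_mono t fun s hs =>
          ⟨ht0.trans hs.1.le, hs.2.trans (min_le_right _ _)⟩
        have h3 : 𝓝[>] t ≤ 𝓝[Icc 0 1] t := by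
          rw [← nhdsWithin_Ioc_eq_nhdsGT (lt_min hy ht1)]
          exact h2
        filter_upwards [h1, h3 hev] with s hs hs'
        exact ⟨⟨hs.1, hs.2.trans (min_le_left _ _)⟩,
          ⟨ht0.trans hs.1.le, hs.2.trans (min_le_right _ _)⟩, hs'⟩
      obtain ⟨t', ht'y, ht'01, ht'⟩ := hev2.exists
      refine ⟨t', fun s hs => ?_, ht'y⟩
      have hsegment := hseg z hz (x t') (hKsub (hx t' ht'01)) (by
        rw [segment_eq_image_lineMap]
        rintro _ ⟨s, hs, rfl⟩
        exact ht' s hs)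
      rw [segment_eq_image_lineMap] at hsegment
      exact image_mono (closedBall_subset_closedBall (max_le hzK (hx t' ht'01)))
        (hsegment (mem_image_of_mem _ hs))
  rw [segment_eq_image_lineMap]
  rintro _ ⟨s, hs, rfl⟩
  have := hsub (right_mem_Icc.mpr zero_le_one) s hs
  simp only [x, AffineMap.lineMap_apply_one] at this
  exact image_mono hKsub this

end Balls

/-! ### The real derivative and the curvature form -/

/-- The real-linear map `u ↦ p u + conj (q u)`, which is the real derivative of `h + conj g` at a
point with `h' = p` and `g' = q`. -/
noncomputable def wirtingerMap (p q : ℂ) : ℂ →L[ℝ] ℂ :=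
  p • (1 : ℂ →L[ℝ] ℂ) +
    (Complex.conjCLE : ℂ →L[ℝ] ℂ).comp (q • (1 : ℂ →L[ℝ] ℂ))

@[simp]
theorem wirtingerMap_apply (p q u : ℂ) : wirtingerMap p q u = p * u + conj (q * u) := by
  simp [wirtingerMap]

theorem sq_norm_sub_sq_norm_pos {p q : ℂ} (hpq : ‖q‖ < ‖p‖) : 0 < ‖p‖ ^ 2 - ‖q‖ ^ 2 := by
  nlinarith [norm_nonneg q]

theorem ofReal_sq_norm_sub_sq_norm (p q : ℂ) :
    ((‖p‖ ^ 2 - ‖q‖ ^ 2 : ℝ) : ℂ) = p * conj p - q * conj q := by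
  push_cast
  rw [Complex.mul_conj', Complex.mul_conj']

/-- `wirtingerMap p q` as an isomorphism when its determinant `|p|² - |q|²` is positive. -/
noncomputable def wirtingerEquiv (p q : ℂ) (hpq : ‖q‖ < ‖p‖) : ℂ ≃L[ℝ] ℂ :=
  ContinuousLinearEquiv.equivOfInverse (wirtingerMap p q)
    (wirtingerMap (conj p / (‖p‖ ^ 2 - ‖q‖ ^ 2 : ℝ)) (-q / (‖p‖ ^ 2 - ‖q‖ ^ 2 : ℝ)))
    (fun u => by
      have h := (sq_norm_sub_sq_norm_pos hpq).ne'
      rw [← Complex.ofReal_ne_zero] at h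
      simp only [wirtingerMap_apply, map_add, map_mul, map_div₀, map_neg, Complex.conj_conj,
        Complex.conj_ofReal]
      have hD := ofReal_sq_norm_sub_sq_norm p q
      generalize ((‖p‖ ^ 2 - ‖q‖ ^ 2 : ℝ) : ℂ) = D at h hD ⊢
      field_simp
      rw [hD]
      ring)
    (fun u => by
      have h := (sq_norm_sub_sq_norm_pos hpq).ne'
      rw [← Complex.ofReal_ne_zero] at h
      simp only [wirtingerMap_apply, map_add, map_mul, map_div₀, map_neg, Complex.conj_conj,
        Complex.conj_ofReal]
      have hD := ofReal_sq_norm_sub_sq_norm p q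
      generalize ((‖p‖ ^ 2 - ‖q‖ ^ 2 : ℝ) : ℂ) = D at h hD ⊢
      field_simp
      rw [hD]
      ring)

@[simp]
theorem wirtingerEquiv_apply (p q : ℂ) (hpq : ‖q‖ < ‖p‖) (u : ℂ) :
    wirtingerEquiv p q hpq u = p * u + conj (q * u) :=
  wirtingerMap_apply p q u

theorem coe_wirtingerEquiv (p q : ℂ) (hpq : ‖q‖ < ‖p‖) :
    (wirtingerEquiv p q hpq : ℂ →L[ℝ] ℂ) = wirtingerMap p q := rfl

theorem wirtingerEquiv_symm_apply (p q : ℂ) (hpq : ‖q‖ < ‖p‖) (w : ℂ) :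
    (wirtingerEquiv p q hpq).symm w =
      (conj p * w - conj q * conj w) / (‖p‖ ^ 2 - ‖q‖ ^ 2 : ℝ) := by
  change wirtingerMap _ _ w = _
  simp only [wirtingerMap_apply, map_mul, map_div₀, map_neg, Complex.conj_ofReal]
  ring

theorem le_norm_wirtingerEquiv (p q : ℂ) (hpq : ‖q‖ < ‖p‖) (u : ℂ) :
    (‖p‖ - ‖q‖) * ‖u‖ ≤ ‖wirtingerEquiv p q hpq u‖ := by
  have := norm_sub_le_norm_add (p * u) (conj (q * u))
  rw [RCLike.norm_conj, norm_mul, norm_mul, ← sub_mul] at this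
  simpa using this

/-- The quantity whose sign decides convexity, for `p = h'`, `q = g'`, `p' = h''`, `q' = g''` at a
point `ζ`, and `e = ζ - a` the position of `ζ` relative to the centre of a disk: up to a positive
factor it is the curvature at `f ζ` of the image under `f = h + conj g` of the circle about `a`
through `ζ`. For `e = 0` the division makes the last term `0`. -/
noncomputable def curvatureForm (p q p' q' e : ℂ) : ℝ :=
  ‖p‖ ^ 2 - ‖q‖ ^ 2 + (e * (p' * conj p - q' * conj q)).re
    - (e ^ 3 / ((‖e‖ ^ 2 : ℝ) : ℂ) * (p' * q - p * q')).re

theorem curvatureForm_zero (p q p' q' : ℂ) :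
    curvatureForm p q p' q' 0 = ‖p‖ ^ 2 - ‖q‖ ^ 2 := by
  simp [curvatureForm]

/-- Apart from the Jacobian, the curvature form is homogeneous of degree one in `e`. -/
theorem curvatureForm_real_smul (p q p' q' e : ℂ) (t : ℝ) :
    curvatureForm p q p' q' (t * e) =
      (1 - t) * (‖p‖ ^ 2 - ‖q‖ ^ 2) + t * curvatureForm p q p' q' e := by
  have h3 : ((t : ℂ) * e) ^ 3 / ((‖(t : ℂ) * e‖ ^ 2 : ℝ) : ℂ) =
      (t : ℂ) * (e ^ 3 / ((‖e‖ ^ 2 : ℝ) : ℂ)) := by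
    rw [norm_mul, Complex.norm_real, mul_pow ‖t‖, Real.norm_eq_abs, sq_abs]
    rcases eq_or_ne t 0 with rfl | ht
    · simp
    · have : (t : ℂ) ≠ 0 := Complex.ofReal_ne_zero.mpr ht
      rw [Complex.ofReal_mul, mul_pow, ← mul_div_mul_left _ _ (pow_ne_zero 2 this)]
      push_cast
      field_simp
  unfold curvatureForm
  rw [h3, mul_assoc (t : ℂ) e, mul_assoc (t : ℂ) (e ^ 3 / _), Complex.re_ofReal_mul,
    Complex.re_ofReal_mul]
  ring

/-- The curvature form in terms of the real derivative `A = wirtingerMap p q` of `f`: the vector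
`A⁻¹ (p' e² + conj (q' e²))` is what both the second derivative of `f` along a circle and that of a
curve with straight image are made of. -/
theorem sq_norm_mul_curvatureForm {p q : ℂ} (hpq : ‖q‖ < ‖p‖) (p' q' e : ℂ) :
    ‖e‖ ^ 2 * curvatureForm p q p' q' e = (‖p‖ ^ 2 - ‖q‖ ^ 2) * (‖e‖ ^ 2 +
      (conj e * (wirtingerEquiv p q hpq).symm (p' * e ^ 2 + conj (q' * e ^ 2))).re) := by
  rcases eq_or_ne e 0 with rfl | he
  · simp
  have hN : ((‖e‖ ^ 2 : ℝ) : ℂ) ≠ 0 := Complex.ofReal_ne_zero.mpr (by positivity)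
  have hJ : ((‖p‖ ^ 2 - ‖q‖ ^ 2 : ℝ) : ℂ) ≠ 0 :=
    Complex.ofReal_ne_zero.mpr (sq_norm_sub_sq_norm_pos hpq).ne'
  have h1 : ‖e‖ ^ 2 * (e ^ 3 / ((‖e‖ ^ 2 : ℝ) : ℂ) * (p' * q - p * q')).re =
      (e ^ 3 * (p' * q - p * q')).re := by
    rw [← Complex.re_ofReal_mul, ← mul_assoc, mul_div_cancel₀ _ hN]
  have h2 : ∀ x : ℂ, (‖p‖ ^ 2 - ‖q‖ ^ 2) * (conj e * (x / (‖p‖ ^ 2 - ‖q‖ ^ 2 : ℝ))).re =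
      (conj e * x).re := by
    intro x
    rw [← Complex.re_ofReal_mul, mul_left_comm, mul_div_cancel₀ _ hJ]
  rw [curvatureForm, mul_sub, h1, wirtingerEquiv_symm_apply, mul_add, mul_add (‖p‖ ^ 2 - ‖q‖ ^ 2),
    h2]
  have h3 : ‖e‖ ^ 2 * (e * (p' * conj p - q' * conj q)).re =
      (conj e * (e ^ 2 * (p' * conj p - q' * conj q))).re := by
    rw [← Complex.re_ofReal_mul, Complex.ofReal_pow, ← Complex.mul_conj']
    congr 1
    ring
  have h4 : (e ^ 3 * (p' * q - p * q')).re =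
      (conj e ^ 3 * (conj p' * conj q - conj p * conj q')).re := by
    rw [← Complex.conj_re]
    simp
  rw [h3, h4]
  have h5 : conj e * (conj p * (p' * e ^ 2 + conj (q' * e ^ 2)) -
        conj q * conj (p' * e ^ 2 + conj (q' * e ^ 2))) =
      conj e * (e ^ 2 * (p' * conj p - q' * conj q)) -
        conj e ^ 3 * (conj p' * conj q - conj p * conj q') := by
    simp only [map_add, map_mul, map_pow, Complex.conj_conj]
    ring
  rw [h5, Complex.sub_re]
  ring

/-! ### Harmonic maps: curvature and convexity of images of disks -/

variable {f h g : ℂ → ℂ}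

namespace IsDecomposition

theorem hasStrictFDerivAt (hf : IsDecomposition f h g) {z : ℂ} (hz : z ∈ ball (0 : ℂ) 1) :
    HasStrictFDerivAt f (wirtingerMap (deriv h z) (deriv g z)) z := by
  have hh := (hf.h_analytic z hz).hasStrictDerivAt.complexToReal_fderiv
  have hg := (hf.g_analytic z hz).hasStrictDerivAt.complexToReal_fderiv
  refine (hh.add (Complex.conjCLE.toContinuousLinearMap.hasStrictFDerivAt.comp z
    hg)).congr_of_eventuallyEq ?_
  filter_upwards [isOpen_ball.mem_nhds hz] with w hw
  simp [hf.eq_add_conj w hw]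

theorem jacobian_eq (hf : IsDecomposition f h g) {z : ℂ} (hz : z ∈ ball (0 : ℂ) 1) :
    jacobian f z = ‖deriv h z‖ ^ 2 - ‖deriv g z‖ ^ 2 := by
  have hfd := (hf.hasStrictFDerivAt hz).hasFDerivAt.fderiv
  have h1 : dz f z = deriv h z := by
    rw [dz, hfd, wirtingerMap_apply, wirtingerMap_apply, map_mul, map_mul, Complex.conj_I, map_one]
    linear_combination (-deriv h z + conj (deriv g z)) / 2 * Complex.I_sq
  have h2 : dzbar f z = conj (deriv g z) := by
    rw [dzbar, hfd, wirtingerMap_apply, wirtingerMap_apply, map_mul, map_mul, Complex.conj_I]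
    rw [map_one]
    linear_combination (deriv h z - conj (deriv g z)) / 2 * Complex.I_sq
  rw [jacobian, h1, h2, RCLike.norm_conj]

theorem norm_deriv_lt (hf : IsDecomposition f h g) (hsp : SensePreserving f) {z : ℂ}
    (hz : z ∈ ball (0 : ℂ) 1) : ‖deriv g z‖ < ‖deriv h z‖ := by
  have := hsp z hz
  rw [hf.jacobian_eq hz] at this
  exact lt_of_pow_lt_pow_left₀ 2 (norm_nonneg _) (by linarith)

theorem hasStrictFDerivAt_equiv (hf : IsDecomposition f h g) (hsp : SensePreserving f) {z : ℂ}
    (hz : z ∈ ball (0 : ℂ) 1) :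
    HasStrictFDerivAt f (wirtingerEquiv (deriv h z) (deriv g z) (hf.norm_deriv_lt hsp hz) :
      ℂ →L[ℝ] ℂ) z :=
  hf.hasStrictFDerivAt hz

theorem continuousOn (hf : IsDecomposition f h g) : ContinuousOn f (ball 0 1) := fun _ hz =>
  (hf.hasStrictFDerivAt hz).continuousAt.continuousWithinAt

theorem locallyUnivalent (hf : IsDecomposition f h g) (hsp : SensePreserving f) :
    LocallyUnivalent f := fun _ hz =>
  exists_injOn_nhds_of_hasStrictFDerivAt_equiv (hf.hasStrictFDerivAt_equiv hsp hz)

theorem isOpen_image (hf : IsDecomposition f h g) (hsp : SensePreserving f) {U : Set ℂ}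
    (hU : IsOpen U) (hUD : U ⊆ ball 0 1) : IsOpen (f '' U) :=
  isOpen_image_of_hasStrictFDerivAt_equiv hU fun _ hz =>
    ⟨_, hf.hasStrictFDerivAt_equiv hsp (hUD hz)⟩

theorem injOn_closedBall (hf : IsDecomposition f h g) (hsp : SensePreserving f) {a : ℂ} {r : ℝ}
    (hr : 0 ≤ r) (hD : closedBall a r ⊆ ball 0 1)
    (hconv : ∀ R ∈ Ioc 0 r, InjOn f (ball a R) → Convex ℝ (f '' ball a R)) :
    InjOn f (closedBall a r) := by
  have hcont : ContinuousOn (fun z => ‖deriv h z‖ - ‖deriv g z‖) (closedBall a r) :=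
    (hf.h_analytic.deriv.continuousOn.mono hD).norm.sub
      (hf.g_analytic.deriv.continuousOn.mono hD).norm
  obtain ⟨x, hx, hmin⟩ := (isCompact_closedBall a r).exists_isMinOn
    ⟨a, mem_closedBall_self hr⟩ hcont
  refine injOn_closedBall_of_convex_image hr (sub_pos.mpr (hf.norm_deriv_lt hsp (hD hx)))
    (fun z hz => ⟨_, hf.hasStrictFDerivAt_equiv hsp (hD hz), fun u => ?_⟩) hconv
  exact (mul_le_mul_of_nonneg_right (hmin hz) (norm_nonneg u)).trans
    (le_norm_wirtingerEquiv _ _ _ u)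

/-- Along a curve `γ` whose image under `f` is a straight line run through with velocity `v ≠ 0`,
the distance from `a` has no local maximum at a point where the curvature form is positive. -/
theorem not_isLocalMax_of_curvatureForm_pos (hf : IsDecomposition f h g)
    (hsp : SensePreserving f) {a v : ℂ} (hv : v ≠ 0) {γ γ' : ℝ → ℂ} {t : ℝ}
    (hmem : γ t ∈ ball (0 : ℂ) 1) (hγ : ∀ᶠ s in 𝓝 t, HasDerivAt γ (γ' s) s)
    (hγ' : DifferentiableAt ℝ γ' t)
    (hstraight : ∀ᶠ s in 𝓝 t, wirtingerMap (deriv h (γ s)) (deriv g (γ s)) (γ' s) = v)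
    (hpos : 0 < curvatureForm (deriv h (γ t)) (deriv g (γ t)) (deriv (deriv h) (γ t))
      (deriv (deriv g) (γ t)) (γ t - a)) :
    ¬ IsLocalMax (fun s => ‖γ s - a‖ ^ 2) t := by
  intro hmax
  have hpq := hf.norm_deriv_lt hsp hmem
  have hγt := hγ.self_of_nhds
  have hp : HasDerivAt (fun s => deriv h (γ s)) (γ' t • deriv (deriv h) (γ t)) t :=
    (hf.h_analytic.deriv _ hmem).differentiableAt.hasDerivAt.scomp t hγt
  have hq : HasDerivAt (fun s => deriv g (γ s)) (γ' t • deriv (deriv g) (γ t)) t :=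
    (hf.g_analytic.deriv _ hmem).differentiableAt.hasDerivAt.scomp t hγt
  obtain ⟨γ'', hγ''⟩ : ∃ γ'', HasDerivAt γ' γ'' t := ⟨_, hγ'.hasDerivAt⟩
  set e := γ t - a with he
  set p := deriv h (γ t)
  set q := deriv g (γ t)
  set p' := deriv (deriv h) (γ t)
  set q' := deriv (deriv g) (γ t)
  -- Differentiating the equation of the straight image determines `γ''`.
  have hacc : γ'' = -(wirtingerEquiv p q hpq).symm (p' * γ' t ^ 2 + conj (q' * γ' t ^ 2)) := by
    have hd := (hp.mul hγ'').add (hq.mul hγ'').star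
    change HasDerivAt _ (γ' t • p' * γ' t + p * γ'' + star (γ' t • q' * γ' t + q * γ'')) t at hd
    have hz := hd.unique ((hasDerivAt_const t v).congr_of_eventuallyEq (by
      filter_upwards [hstraight] with s hs
      simpa using hs))
    have hz' : p * γ'' + conj (q * γ'') + (p' * γ' t ^ 2 + conj (q' * γ' t ^ 2)) = 0 := by
      rw [← hz]
      simp only [smul_eq_mul, map_add, map_mul, map_pow, ← starRingEnd_apply]
      ring
    rw [eq_neg_iff_add_eq_zero, ← map_eq_zero_iff _ (wirtingerEquiv p q hpq).injective, map_add,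
      ContinuousLinearEquiv.apply_symm_apply, wirtingerEquiv_apply]
    exact hz'
  have h1 : ∀ᶠ s in 𝓝 t, HasDerivAt (fun s => ‖γ s - a‖ ^ 2) (2 * inner ℝ (γ s - a) (γ' s)) s :=
    hγ.mono fun s hs => (hs.sub_const a).norm_sq
  have h2 : HasDerivAt (fun s => 2 * inner ℝ (γ s - a) (γ' s))
      (2 * (inner ℝ e γ'' + inner ℝ (γ' t) (γ' t))) t :=
    ((hγt.sub_const a).inner ℝ hγ'').const_mul 2
  have hinner : ∀ x y : ℂ, inner ℝ x y = (conj x * y).re := fun x y => by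
    rw [Complex.inner, mul_comm]
  have hcrit : (conj e * γ' t).re = 0 := by
    have := hmax.hasDerivAt_eq_zero h1.self_of_nhds
    rwa [hinner, mul_eq_zero, or_iff_right two_ne_zero] at this
  have hsecond := second_deriv_nonpos_of_isLocalMax hmax h1 h2
  rw [hinner, real_inner_self_eq_norm_sq] at hsecond
  have hγ'0 : γ' t ≠ 0 := by
    intro h0
    have := hstraight.self_of_nhds
    rw [h0, map_zero] at this
    exact hv this.symm
  have hγ'pos : 0 < ‖γ' t‖ ^ 2 := by positivity
  have he0 : e ≠ 0 := by
    intro h0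
    rw [h0] at hsecond
    simp only [map_zero, zero_mul, Complex.zero_re, zero_add] at hsecond
    linarith
  have hepos : 0 < ‖e‖ ^ 2 := by positivity
  -- At a critical point of the distance, the velocity is tangent to the circle about `a`.
  obtain ⟨s, hs⟩ : ∃ s : ℝ, γ' t = s * (Complex.I * e) := by
    refine ⟨(conj e * γ' t).im / ‖e‖ ^ 2, ?_⟩
    have hN : (‖e‖ : ℂ) ^ 2 ≠ 0 := by exact_mod_cast hepos.ne'
    have hc : conj e * γ' t = ((conj e * γ' t).im : ℂ) * Complex.I := by
      conv_lhs => rw [← Complex.re_add_im (conj e * γ' t), hcrit, Complex.ofReal_zero, zero_add]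
    push_cast
    rw [div_mul_eq_mul_div, eq_div_iff hN, ← mul_assoc, ← hc, ← Complex.mul_conj']
    ring
  have hs0 : s ≠ 0 := by
    rintro rfl
    simp [hs] at hγ'0
  have hsq : p' * γ' t ^ 2 + conj (q' * γ' t ^ 2) =
      (-s ^ 2 : ℝ) • (p' * e ^ 2 + conj (q' * e ^ 2)) := by
    rw [hs, Complex.real_smul]
    simp only [map_mul, map_pow, Complex.conj_ofReal, Complex.conj_I]
    push_cast
    linear_combination (s ^ 2 * (p' * e ^ 2 + conj q' * conj e ^ 2)) * Complex.I_sq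
  have hnorm : ‖γ' t‖ ^ 2 = s ^ 2 * ‖e‖ ^ 2 := by
    rw [hs, norm_mul, norm_mul, Complex.norm_I, one_mul, mul_pow, Complex.norm_real,
      Real.norm_eq_abs, sq_abs]
  have hJ := sq_norm_sub_sq_norm_pos hpq
  have hkey := sq_norm_mul_curvatureForm hpq p' q' e
  rw [hacc, hsq, map_smul, ← neg_smul, neg_neg, Complex.real_smul, mul_left_comm,
    Complex.re_ofReal_mul, hnorm, ← mul_add] at hsecond
  have h3 : 0 < ‖e‖ ^ 2 + (conj e *
      (wirtingerEquiv p q hpq).symm (p' * e ^ 2 + conj (q' * e ^ 2))).re := by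
    have : 0 < ‖e‖ ^ 2 * curvatureForm p q p' q' e := mul_pos hepos hpos
    rw [hkey] at this
    exact (mul_pos_iff_of_pos_left hJ).mp this
  have h4 : 0 < s ^ 2 := by positivity
  nlinarith [mul_pos h4 h3]

/-- Positive curvature form and injectivity give convexity: the preimage of a segment cannot bulge
out of the smallest concentric disk that contains its end points. -/
theorem convex_image_ball_of_curvatureForm_pos (hf : IsDecomposition f h g)
    (hsp : SensePreserving f) {a : ℂ} {R : ℝ} (hD : ball a R ⊆ ball 0 1)
    (hpos : ∀ ζ ∈ ball a R, 0 < curvatureForm (deriv h ζ) (deriv g ζ) (deriv (deriv h) ζ)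
      (deriv (deriv g) ζ) (ζ - a))
    (hinj : InjOn f (ball a R)) : Convex ℝ (f '' ball a R) := by
  have hopen : IsOpen (f '' ball a R) := hf.isOpen_image hsp isOpen_ball hD
  refine convex_image_ball_of_segment (hf.continuousOn.mono hD) hopen ?_
  intro z hz w hw hseg
  rcases eq_or_ne (f z) (f w) with hzw | hzw
  · rw [← hzw, segment_same, singleton_subset_iff]
    exact mem_image_of_mem f (mem_closedBall.mpr (le_max_left _ _))
  let F := Function.invFunOn f (ball a R)
  have hleft : ∀ x ∈ ball a R, F (f x) = x := fun x hx => hinj.leftInvOn_invFunOn hx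
  have hFmem : ∀ y ∈ f '' ball a R, F y ∈ ball a R := fun y hy => Function.invFunOn_mem hy
  have hright : ∀ y ∈ f '' ball a R, f (F y) = y := fun y hy => Function.invFunOn_eq hy
  let σ : ℝ → ℂ := fun t => AffineMap.lineMap (f z) (f w) t
  let γ : ℝ → ℂ := fun t => F (σ t)
  let v := f w - f z
  have hσ : ∀ t, HasDerivAt σ v t := fun t => AffineMap.hasDerivAt_lineMap
  let γ' : ℝ → ℂ := fun t => (conj (deriv h (γ t)) * v - conj (deriv g (γ t)) * conj v) /
    (deriv h (γ t) * conj (deriv h (γ t)) - deriv g (γ t) * conj (deriv g (γ t)))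
  have hγ' : ∀ t (ht : γ t ∈ ball (0 : ℂ) 1), γ' t = (wirtingerEquiv (deriv h (γ t))
      (deriv g (γ t)) (hf.norm_deriv_lt hsp ht)).symm v := fun t ht => by
    rw [wirtingerEquiv_symm_apply, ofReal_sq_norm_sub_sq_norm]
  have hder : ∀ t, σ t ∈ f '' ball a R → HasDerivAt γ (γ' t) t := by
    intro t ht
    have hmem := hFmem _ ht
    rw [hγ' t (hD hmem)]
    have hF := ((hf.hasStrictFDerivAt_equiv hsp (hD hmem)).to_local_left_inverse
      (eventually_of_mem (isOpen_ball.mem_nhds hmem) hleft)).hasFDerivAt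
    rw [hright _ ht] at hF
    exact hF.comp_hasDerivAt t (hσ t)
  have hIcc : ∀ t ∈ Icc (0 : ℝ) 1, σ t ∈ f '' ball a R := fun t ht => by
    rw [segment_eq_image_lineMap] at hseg
    exact hseg (mem_image_of_mem _ ht)
  have hcont : ContinuousOn (fun t => ‖γ t - a‖ ^ 2) (Icc 0 1) := fun t ht =>
    (((hder t (hIcc t ht)).continuousAt.sub continuousAt_const).norm.pow 2).continuousWithinAt
  obtain ⟨t₀, ht₀, hmax⟩ := isCompact_Icc.exists_isMaxOn ⟨0, by simp⟩ hcont
  set ρ := max (dist z a) (dist w a) with hρ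
  have hend : ‖γ t₀ - a‖ ≤ ρ := by
    rcases ht₀.1.eq_or_lt with h0 | h0
    · have : γ t₀ = z := by simp [γ, σ, ← h0, hleft z hz]
      rw [this, ← dist_eq_norm]
      exact le_max_left _ _
    rcases ht₀.2.eq_or_lt with h1 | h1
    · have : γ t₀ = w := by simp [γ, σ, h1, hleft w hw]
      rw [this, ← dist_eq_norm]
      exact le_max_right _ _
    exfalso
    have hmem := hFmem _ (hIcc t₀ ht₀)
    have hev : ∀ᶠ s in 𝓝 t₀, σ s ∈ f '' ball a R :=
      (hσ t₀).continuousAt.eventually_mem (hopen.mem_nhds (hIcc t₀ ht₀))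
    refine hf.not_isLocalMax_of_curvatureForm_pos hsp (sub_ne_zero.mpr hzw.symm) (hD hmem)
      (hev.mono hder) ?_ ?_ (hpos _ hmem) (hmax.isLocalMax (Icc_mem_nhds h0 h1))
    · have hγt := hder t₀ (hIcc t₀ ht₀)
      have hp : DifferentiableAt ℝ (fun s => deriv h (γ s)) t₀ :=
        DifferentiableAt.comp (g := deriv h) t₀
          ((hf.h_analytic.deriv _ (hD hmem)).differentiableAt.restrictScalars ℝ)
          hγt.differentiableAt
      have hq : DifferentiableAt ℝ (fun s => deriv g (γ s)) t₀ :=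
        DifferentiableAt.comp (g := deriv g) t₀
          ((hf.g_analytic.deriv _ (hD hmem)).differentiableAt.restrictScalars ℝ)
          hγt.differentiableAt
      have hpc : DifferentiableAt ℝ (fun s => conj (deriv h (γ s))) t₀ := hp.star
      have hqc : DifferentiableAt ℝ (fun s => conj (deriv g (γ s))) t₀ := hq.star
      refine ((hpc.mul_const v).sub (hqc.mul_const _)).div ((hp.mul hpc).sub (hq.mul hqc)) ?_
      have := (sq_norm_sub_sq_norm_pos (hf.norm_deriv_lt hsp (hD hmem))).ne'
      rw [← Complex.ofReal_ne_zero, ofReal_sq_norm_sub_sq_norm] at this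
      exact this
    · filter_upwards [hev] with s hs
      have hs' := hD (hFmem _ hs)
      rw [hγ' s hs', ← coe_wirtingerEquiv _ _ (hf.norm_deriv_lt hsp hs')]
      exact ContinuousLinearEquiv.apply_symm_apply _ _
  rw [segment_eq_image_lineMap]
  rintro _ ⟨t, ht, rfl⟩
  refine ⟨γ t, ?_, hright _ (hIcc t ht)⟩
  rw [mem_closedBall_iff_norm]
  exact (pow_le_pow_iff_left₀ (norm_nonneg _) (norm_nonneg _) two_ne_zero).mp (hmax ht)
    |>.trans hend

/-- A supporting line of the convex image at the boundary point `f ζ` makes a linear functional of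
`f` maximal at `ζ` on the closed disk; its second derivative along the boundary circle is then
nonpositive. -/
theorem curvatureForm_nonneg_of_convex_image (hf : IsDecomposition f h g)
    (hsp : SensePreserving f) {a ζ : ℂ} {r : ℝ} (hr : 0 < r) (hD : closedBall a r ⊆ ball 0 1)
    (hζ : ‖ζ - a‖ = r) (hinj : InjOn f (closedBall a r)) (hconv : Convex ℝ (f '' ball a r)) :
    0 ≤ curvatureForm (deriv h ζ) (deriv g ζ) (deriv (deriv h) ζ) (deriv (deriv g) ζ)
      (ζ - a) := by
  have hζK : ζ ∈ closedBall a r := mem_closedBall_iff_norm.mpr hζ.le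
  have hζD := hD hζK
  have hpq := hf.norm_deriv_lt hsp hζD
  have hopen : IsOpen (f '' ball a r) :=
    hf.isOpen_image hsp isOpen_ball (ball_subset_closedBall.trans hD)
  have hnot : f ζ ∉ f '' ball a r := by
    rintro ⟨x, hx, hxζ⟩
    rw [hinj (ball_subset_closedBall hx) hζK hxζ, mem_ball_iff_norm, hζ] at hx
    exact lt_irrefl _ hx
  obtain ⟨l, hl⟩ := geometric_hahn_banach_open_point hconv hopen hnot
  have hmax : IsMaxOn (fun z => l (f z)) (closedBall a r) ζ := by
    have hlc : ContinuousOn (fun z => l (f z)) (closedBall a r) :=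
      l.continuous.comp_continuousOn (hf.continuousOn.mono hD)
    have hcl : IsClosed {z ∈ closedBall a r | l (f z) ≤ l (f ζ)} :=
      isClosed_closedBall.isClosed_le hlc continuousOn_const
    have hsub : closedBall a r ⊆ {z ∈ closedBall a r | l (f z) ≤ l (f ζ)} := by
      rw [← closure_ball a hr.ne'] at hcl ⊢
      exact closure_minimal (fun z hz => ⟨subset_closure hz, (hl _ (mem_image_of_mem f hz)).le⟩)
        hcl
    exact fun z hz => (hsub hz).2
  set e := ζ - a with he
  have heζ : a + e = ζ := by rw [he]; ring
  set p := deriv h ζ with hp_def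
  set q := deriv g ζ with hq_def
  set p' := deriv (deriv h) ζ with hp'_def
  set q' := deriv (deriv g) ζ with hq'_def
  let A := wirtingerEquiv p q hpq
  let m : ℂ →L[ℝ] ℝ := l.comp (A : ℂ →L[ℝ] ℂ)
  have hm : ∀ u, m u = l (p * u + conj (q * u)) := fun u => by
    simp only [m, A, ContinuousLinearMap.comp_apply, ContinuousLinearEquiv.coe_coe,
      wirtingerEquiv_apply]
  have hepos : 0 < ‖e‖ ^ 2 := by rw [hζ]; positivity
  have hradial : 0 ≤ m e := by
    have hfd : HasFDerivWithinAt (fun z => l (f z)) m (closedBall a r) ζ :=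
      (l.hasFDerivAt.comp ζ
        (hf.hasStrictFDerivAt_equiv hsp hζD).hasFDerivAt).hasFDerivWithinAt
    have := hmax.localize.hasFDerivWithinAt_nonpos hfd (y := -e)
      (mem_posTangentConeAt_of_segment_subset ((convex_closedBall a r).segment_subset hζK (by
        rw [← heζ, add_neg_cancel_right]
        exact mem_closedBall_self hr.le)))
    rw [map_neg] at this
    linarith
  -- The boundary circle, with velocity `E`.
  let c : ℝ → ℂ := fun t => a + e * Complex.exp (t * Complex.I)
  let E : ℝ → ℂ := fun t => Complex.I * (e * Complex.exp (t * Complex.I))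
  have hc0 : c 0 = ζ := by simp [c, heζ]
  have hE0 : E 0 = Complex.I * e := by simp [E]
  have hexp : ∀ t : ℝ, HasDerivAt (fun t : ℝ => e * Complex.exp (t * Complex.I)) (E t) t := by
    intro t
    have h1 : HasDerivAt (fun t : ℝ => (t : ℂ) * Complex.I) Complex.I t := by
      simpa using ((hasDerivAt_id (t : ℂ)).comp_ofReal).mul_const Complex.I
    refine (h1.cexp.const_mul e).congr_deriv ?_
    simp only [E]
    ring
  have hcd : ∀ t, HasDerivAt c (E t) t := fun t => (hexp t).const_add a
  have hEd : HasDerivAt E (-e) 0 := by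
    refine ((hexp 0).const_mul Complex.I).congr_deriv ?_
    rw [hE0, ← mul_assoc, Complex.I_mul_I]
    ring
  have hcK : ∀ t, c t ∈ closedBall a r := fun t => by
    rw [mem_closedBall_iff_norm, add_sub_cancel_left, norm_mul, Complex.norm_exp_ofReal_mul_I,
      mul_one, hζ]
  have hcmax : IsLocalMax (fun t => l (f (c t))) 0 :=
    Eventually.of_forall fun t => by
      change l (f (c t)) ≤ l (f (c 0))
      rw [hc0]
      exact hmax (hcK t)
  have hd1 : ∀ t, HasDerivAt (fun t => l (f (c t)))
      (l (deriv h (c t) * E t + conj (deriv g (c t) * E t))) t := fun t => by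
    rw [← wirtingerMap_apply]
    exact l.hasFDerivAt.comp_hasDerivAt t
      ((hf.hasStrictFDerivAt (hD (hcK t))).hasFDerivAt.comp_hasDerivAt t (hcd t))
  have hd2 : HasDerivAt (fun t => l (deriv h (c t) * E t + conj (deriv g (c t) * E t)))
      (-(m e + l (p' * e ^ 2 + conj (q' * e ^ 2)))) 0 := by
    have hc0D : c 0 ∈ ball (0 : ℂ) 1 := hD (hcK 0)
    have hp : HasDerivAt (fun s => deriv h (c s)) (E 0 • deriv (deriv h) (c 0)) 0 :=
      (hf.h_analytic.deriv _ hc0D).differentiableAt.hasDerivAt.scomp 0 (hcd 0)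
    have hq : HasDerivAt (fun s => deriv g (c s)) (E 0 • deriv (deriv g) (c 0)) 0 :=
      (hf.g_analytic.deriv _ hc0D).differentiableAt.hasDerivAt.scomp 0 (hcd 0)
    refine (l.hasFDerivAt.comp_hasDerivAt 0 ((hp.mul hEd).add (hq.mul hEd).star)).congr_deriv ?_
    rw [hm, ← map_add, ← map_neg]
    congr 1
    rw [hE0, hc0, ← hp'_def, ← hq'_def, ← hp_def, ← hq_def]
    simp only [smul_eq_mul, map_add, map_mul, map_pow, ← starRingEnd_apply, map_neg,
      Complex.conj_I]
    linear_combination (p' * e ^ 2 + conj q' * conj e ^ 2) * Complex.I_sq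
  have htangent : m (Complex.I * e) = 0 := by
    have := hcmax.hasDerivAt_eq_zero (hd1 0)
    rwa [hE0, hc0, ← hm] at this
  have hsecond := second_deriv_nonpos_of_isLocalMax hcmax (Eventually.of_forall hd1) hd2
  have hdecomp : ∀ u, ‖e‖ ^ 2 * m u = (conj e * u).re * m e := by
    intro u
    have hu : (‖e‖ ^ 2) • u = (conj e * u).re • e + (conj e * u).im • (Complex.I * e) := by
      simp only [Complex.real_smul]
      push_cast
      rw [← Complex.mul_conj']
      linear_combination -e * Complex.re_add_im (conj e * u)
    have := congrArg m hu
    rwa [map_add, map_smul, map_smul, map_smul, htangent, smul_zero, add_zero, smul_eq_mul,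
      smul_eq_mul] at this
  have hme : 0 < m e := by
    refine hradial.lt_of_ne fun h0 => ?_
    have hm0 : ∀ u, m u = 0 := fun u => by
      have := hdecomp u
      rw [← h0, mul_zero] at this
      exact (mul_eq_zero.mp this).resolve_left hepos.ne'
    have hl0 : ∀ u, l u = 0 := fun u => by
      have := hm0 (A.symm u)
      simpa [m] using this
    have := hl _ (mem_image_of_mem f (mem_ball_self hr))
    rw [hl0, hl0] at this
    exact lt_irrefl _ this
  have hB : l (p' * e ^ 2 + conj (q' * e ^ 2)) = m (A.symm (p' * e ^ 2 + conj (q' * e ^ 2))) := by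
    simp [m]
  have hdec := hdecomp (A.symm (p' * e ^ 2 + conj (q' * e ^ 2)))
  rw [← hB] at hdec
  have hkey := sq_norm_mul_curvatureForm hpq p' q' e
  have hJ := sq_norm_sub_sq_norm_pos hpq
  have h1 : 0 ≤ (‖e‖ ^ 2 + (conj e * A.symm (p' * e ^ 2 + conj (q' * e ^ 2))).re) * m e := by
    rw [add_mul, ← hdec, ← mul_add]
    exact mul_nonneg hepos.le (by linarith)
  have h2 := nonneg_of_mul_nonneg_left h1 hme
  exact nonneg_of_mul_nonneg_right (hkey ▸ mul_nonneg hJ.le h2) hepos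

end IsDecomposition

/-! ### Hyperbolic centres and the analytic inequality -/

theorem sq_norm_mul_re_div (x p : ℂ) : ‖p‖ ^ 2 * (x / p).re = (x * conj p).re := by
  rcases eq_or_ne p 0 with rfl | hp
  · simp
  rw [← Complex.re_ofReal_mul, Complex.ofReal_pow, ← Complex.mul_conj']
  congr 1
  field_simp

/-- The vector `(ζ - b) (1 - conj b ζ)` is normal to the hyperbolic circle about `b` through `ζ`; it
is `circleRatio ζ b` times the position of `ζ` relative to the Euclidean centre of that circle. -/
noncomputable def circleRatio (ζ b : ℂ) : ℝ := 1 + ‖b‖ ^ 2 - 2 * (conj b * ζ).re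

theorem circleRatio_eq_left (ζ b : ℂ) : circleRatio ζ b = ‖ζ - b‖ ^ 2 + (1 - ‖ζ‖ ^ 2) := by
  simp only [circleRatio, Complex.sq_norm, Complex.normSq_apply, Complex.sub_re, Complex.sub_im,
    Complex.mul_re, Complex.conj_re, Complex.conj_im]
  ring

theorem circleRatio_eq_right (ζ b : ℂ) :
    circleRatio ζ b = ‖1 - ζ * conj b‖ ^ 2 + ‖b‖ ^ 2 * (1 - ‖ζ‖ ^ 2) := by
  simp only [circleRatio, Complex.sq_norm, Complex.normSq_apply, Complex.sub_re, Complex.sub_im,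
    Complex.mul_re, Complex.mul_im, Complex.conj_re, Complex.conj_im, Complex.one_re,
    Complex.one_im]
  ring

theorem circleRatio_pos {ζ : ℂ} (hζ : ‖ζ‖ < 1) (b : ℂ) : 0 < circleRatio ζ b := by
  rw [circleRatio_eq_left]
  nlinarith [norm_nonneg ζ, sq_nonneg ‖ζ - b‖]

theorem circleRatio_mul_sub (ζ b : ℂ) :
    (circleRatio ζ b : ℂ) * ζ - (ζ - b) * (1 - ζ * conj b) = ((1 - ‖ζ‖ ^ 2 : ℝ) : ℂ) * b := by
  have h : (circleRatio ζ b : ℂ) = 1 + b * conj b - (conj b * ζ + conj (conj b * ζ)) := by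
    rw [Complex.add_conj, Complex.mul_conj', circleRatio]
    push_cast
    ring
  rw [h]
  push_cast
  rw [← Complex.mul_conj', map_mul, Complex.conj_conj]
  ring

/-- The difference of the two sides of the analytic inequality for convexity is, up to the positive
factor `circleRatio ζ b`, the curvature form of the Euclidean circle through `ζ` with hyperbolic
centre `b`. -/
theorem sub_eq_curvatureForm (p q p' q' ζ b : ℂ) :
    ‖p‖ ^ 2 * (1 + ‖b‖ ^ 2 +
        ((ζ - b) * (1 - ζ * conj b) * p' / p - 2 * conj b * ζ).re) -
      (‖q‖ ^ 2 * (1 + ‖b‖ ^ 2 +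
          ((ζ - b) * (1 - ζ * conj b) * q' / q - 2 * conj b * ζ).re)
        + ((ζ - b) ^ 3 * (1 - ζ * conj b) ^ 3
            / (((‖ζ - b‖ ^ 2 * ‖1 - ζ * conj b‖ ^ 2 : ℝ)) : ℂ) * (p' * q - p * q')).re) =
      (circleRatio ζ b - 1) * (‖p‖ ^ 2 - ‖q‖ ^ 2) +
        curvatureForm p q p' q' ((ζ - b) * (1 - ζ * conj b)) := by
  have hp := sq_norm_mul_re_div ((ζ - b) * (1 - ζ * conj b) * p') p
  have hq := sq_norm_mul_re_div ((ζ - b) * (1 - ζ * conj b) * q') q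
  have h2 : (2 * conj b * ζ).re = 2 * (conj b * ζ).re := by
    rw [mul_assoc, ← Complex.ofReal_ofNat, Complex.re_ofReal_mul]
  rw [curvatureForm, norm_mul, mul_pow ‖ζ - b‖, mul_pow (ζ - b), Complex.sub_re, Complex.sub_re, h2,
    mul_sub ((ζ - b) * (1 - ζ * conj b)), Complex.sub_re, ← mul_assoc, ← mul_assoc _ q', ← hp, ← hq,
    circleRatio]
  ring

/-- A hyperbolic circle is a Euclidean circle compactly contained in the unit disk. -/
theorem norm_center_add_radius_lt {ζ b : ℂ} (hζ : ‖ζ‖ < 1) (hb : ‖b‖ < 1) :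
    ‖ζ - ((circleRatio ζ b)⁻¹ : ℝ) * ((ζ - b) * (1 - ζ * conj b))‖ +
      ‖((circleRatio ζ b)⁻¹ : ℝ) * ((ζ - b) * (1 - ζ * conj b))‖ < 1 := by
  have hm := circleRatio_pos hζ b
  have hm' : (circleRatio ζ b : ℂ) ≠ 0 := Complex.ofReal_ne_zero.mpr hm.ne'
  have hu : 0 < 1 - ‖ζ‖ ^ 2 := by nlinarith [norm_nonneg ζ]
  have hcenter : ζ - ((circleRatio ζ b)⁻¹ : ℝ) * ((ζ - b) * (1 - ζ * conj b)) =
      ((circleRatio ζ b)⁻¹ : ℝ) * (((1 - ‖ζ‖ ^ 2 : ℝ) : ℂ) * b) := by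
    rw [← circleRatio_mul_sub, Complex.ofReal_inv, mul_sub _ (_ * ζ), inv_mul_cancel_left₀ hm']
  rw [hcenter, norm_mul, norm_mul, norm_mul _ ((ζ - b) * _), norm_mul (ζ - b), Complex.norm_real,
    Complex.norm_real, Real.norm_of_nonneg (inv_pos.mpr hm).le, Real.norm_of_nonneg hu.le,
    ← mul_add, inv_mul_lt_one₀ hm]
  -- Half the sum of the two formulas for the ratio, and the inequality of the means.
  have h1 := circleRatio_eq_left ζ b
  have h2 := circleRatio_eq_right ζ b
  nlinarith [sq_nonneg (‖ζ - b‖ - ‖1 - ζ * conj b‖), mul_pos hu (pow_pos (sub_pos.mpr hb) 2)]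

/-- Every closed disk in the unit disk has a hyperbolic centre `b`. It is a multiple `t a` of the
Euclidean centre, with `t` the smaller root of `|a|² t² - (1 + |a|² - r²) t + 1`. -/
theorem exists_hyperbolic_center {a : ℂ} {r : ℝ} (hr : 0 ≤ r) (har : ‖a‖ + r < 1) :
    ∃ b : ℂ, ‖b‖ < 1 ∧ ∀ ζ, ‖ζ - a‖ = r →
      (ζ - b) * (1 - ζ * conj b) = circleRatio ζ b * (ζ - a) := by
  have ha := norm_nonneg a
  set S := 1 + ‖a‖ ^ 2 - r ^ 2 with hS
  have hS2 : 2 * ‖a‖ < S := by nlinarith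
  have hD : 0 ≤ S ^ 2 - 4 * ‖a‖ ^ 2 := by nlinarith
  set s := Real.sqrt (S ^ 2 - 4 * ‖a‖ ^ 2) with hs
  have hs0 : 0 ≤ s := Real.sqrt_nonneg _
  have hs2 : s ^ 2 = S ^ 2 - 4 * ‖a‖ ^ 2 := Real.sq_sqrt hD
  have hSs : 0 < S + s := by linarith
  obtain ⟨t, ht⟩ : ∃ t, t = 2 / (S + s) := ⟨_, rfl⟩
  have ht0 : 0 ≤ t := by rw [ht]; positivity
  have hroot : t ^ 2 * ‖a‖ ^ 2 - S * t + 1 = 0 := by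
    rw [ht]
    field_simp
    linear_combination hs2
  refine ⟨t * a, ?_, fun ζ hζ => ?_⟩
  · rw [norm_mul, Complex.norm_real, Real.norm_of_nonneg ht0, ht, div_mul_eq_mul_div,
      div_lt_one hSs]
    linarith
  · have hm : circleRatio ζ (t * a) = t * (1 - ‖ζ‖ ^ 2) := by
      have h1 : r ^ 2 = ‖ζ‖ ^ 2 + ‖a‖ ^ 2 - 2 * (conj a * ζ).re := by
        rw [← hζ]
        simp only [Complex.sq_norm, Complex.normSq_apply, Complex.sub_re, Complex.sub_im,
          Complex.mul_re, Complex.conj_re, Complex.conj_im]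
        ring
      rw [circleRatio, map_mul, Complex.conj_ofReal, mul_assoc, Complex.re_ofReal_mul, norm_mul,
        Complex.norm_real, Real.norm_of_nonneg ht0]
      linear_combination hroot - t * h1 + t * hS
    have hsub := circleRatio_mul_sub ζ (t * a)
    have hmc : (circleRatio ζ (t * a) : ℂ) = t * ((1 - ‖ζ‖ ^ 2 : ℝ) : ℂ) := by
      rw [hm, Complex.ofReal_mul]
    linear_combination a * hmc - hsub

theorem closedBall_subset_unitBall {a : ℂ} {r : ℝ} (har : ‖a‖ + r < 1) :
    closedBall a r ⊆ ball 0 1 := by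
  refine closedBall_subset_ball' ?_
  rw [dist_zero_right]
  linarith

/-- Nonnegativity of the curvature form for all circles gives positivity: the circle through `ζ`
about `a` lies inside a larger one with the same tangent at `ζ`, and the form is homogeneous apart
from the positive Jacobian. -/
theorem IsDecomposition.curvatureForm_pos (hf : IsDecomposition f h g) (hsp : SensePreserving f)
    (hE : ∀ ζ ∈ ball (0 : ℂ) 1, ∀ b ∈ ball (0 : ℂ) 1,
      0 ≤ (circleRatio ζ b - 1) * (‖deriv h ζ‖ ^ 2 - ‖deriv g ζ‖ ^ 2) +
        curvatureForm (deriv h ζ) (deriv g ζ) (deriv (deriv h) ζ) (deriv (deriv g) ζ)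
          ((ζ - b) * (1 - ζ * conj b)))
    {a ζ : ℂ} (haζ : ‖a‖ + ‖ζ - a‖ < 1) :
    0 < curvatureForm (deriv h ζ) (deriv g ζ) (deriv (deriv h) ζ) (deriv (deriv g) ζ) (ζ - a) := by
  have hζ : ζ ∈ ball (0 : ℂ) 1 :=
    closedBall_subset_unitBall haζ (mem_closedBall_iff_norm.mpr le_rfl)
  have hJ := sq_norm_sub_sq_norm_pos (hf.norm_deriv_lt hsp hζ)
  have ha := norm_nonneg a
  have hr := norm_nonneg (ζ - a)
  obtain ⟨η, hη⟩ : ∃ η, η = (1 - ‖a‖ - ‖ζ - a‖) / 2 := ⟨_, rfl⟩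
  have hη0 : 0 < η := by linarith
  have hsub : ζ - (ζ - ((1 + η : ℝ) : ℂ) * (ζ - a)) = ((1 + η : ℝ) : ℂ) * (ζ - a) := by ring
  have hrad : ‖ζ - (ζ - ((1 + η : ℝ) : ℂ) * (ζ - a))‖ = (1 + η) * ‖ζ - a‖ := by
    rw [hsub, norm_mul, Complex.norm_real, Real.norm_of_nonneg (by linarith)]
  have hcen : ‖ζ - ((1 + η : ℝ) : ℂ) * (ζ - a)‖ ≤ ‖a‖ + η * ‖ζ - a‖ := by
    have : ζ - ((1 + η : ℝ) : ℂ) * (ζ - a) = a - (η : ℂ) * (ζ - a) := by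
      push_cast
      ring
    rw [this]
    refine (norm_sub_le _ _).trans_eq ?_
    rw [norm_mul, Complex.norm_real, Real.norm_of_nonneg hη0.le]
  obtain ⟨b, hb, hbζ⟩ := exists_hyperbolic_center (a := ζ - ((1 + η : ℝ) : ℂ) * (ζ - a))
    (r := (1 + η) * ‖ζ - a‖) (by positivity) (by nlinarith)
  have hm := circleRatio_pos (mem_ball_zero_iff.mp hζ) b
  have h0 := hE ζ hζ b (mem_ball_zero_iff.mpr hb)
  rw [hbζ ζ hrad, hsub, ← mul_assoc, ← Complex.ofReal_mul, curvatureForm_real_smul] at h0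
  set C := curvatureForm (deriv h ζ) (deriv g ζ) (deriv (deriv h) ζ) (deriv (deriv g) ζ) (ζ - a)
  have h1 : 0 ≤ circleRatio ζ b *
      ((1 + η) * C - η * (‖deriv h ζ‖ ^ 2 - ‖deriv g ζ‖ ^ 2)) := by
    linarith
  have h2 := nonneg_of_mul_nonneg_right h1 hm
  have h3 := mul_pos hη0 hJ
  exact pos_of_mul_pos_right (by linarith : 0 < (1 + η) * C) (by linarith)

/-- Images of increasing disks are nested, so convexity passes to the largest disk. -/
theorem convex_image_ball_of_lt {f : ℂ → ℂ} {a : ℂ} {r : ℝ}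
    (hconv : ∀ R ∈ Ioo 0 r, Convex ℝ (f '' ball a R)) : Convex ℝ (f '' ball a r) := by
  rw [convex_iff_segment_subset]
  rintro _ ⟨z, hz, rfl⟩ _ ⟨w, hw, rfl⟩
  obtain ⟨R, hR, hRr⟩ := exists_between (max_lt (mem_ball.mp hz) (mem_ball.mp hw))
  have hR0 : 0 < R := (dist_nonneg.trans (le_max_left _ _)).trans_lt hR
  exact ((hconv R ⟨hR0, hRr⟩).segment_subset
    (mem_image_of_mem f (mem_ball.mpr ((le_max_left _ _).trans_lt hR)))
    (mem_image_of_mem f (mem_ball.mpr ((le_max_right _ _).trans_lt hR)))).trans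
    (image_mono (ball_subset_ball hRr.le))

end HarmonicDisk

/-- In the third item the term with factor `|g'(ζ)|²` is read as `0` at zeros of `g'`, and the
last term as `0` for `ζ = b`; these are the continuous extensions, and they are the values that
Lean's division gives. The function `h'` has no zero. -/
theorem theorem1 (f h g : ℂ → ℂ) (hf : HarmonicDisk.IsDecomposition f h g)
    (hsp : HarmonicDisk.SensePreserving f) :
    List.TFAE [
      f ∈ HarmonicDisk.classAK,
      f ∈ HarmonicDisk.classAKTilde,
      ∀ ζ ∈ Metric.ball (0 : ℂ) 1, ∀ b ∈ Metric.ball (0 : ℂ) 1,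
        ‖deriv g ζ‖ ^ 2 * (1 + ‖b‖ ^ 2 +
            ((ζ - b) * (1 - ζ * conj b) * deriv (deriv g) ζ / deriv g ζ - 2 * conj b * ζ).re)
          + ((ζ - b) ^ 3 * (1 - ζ * conj b) ^ 3
              / (((‖ζ - b‖ ^ 2 * ‖1 - ζ * conj b‖ ^ 2 : ℝ)) : ℂ)
              * (deriv (deriv h) ζ * deriv g ζ - deriv h ζ * deriv (deriv g) ζ)).re
        ≤ ‖deriv h ζ‖ ^ 2 * (1 + ‖b‖ ^ 2 +
            ((ζ - b) * (1 - ζ * conj b) * deriv (deriv h) ζ / deriv h ζ - 2 * conj b * ζ).re)] := by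
  have hE := fun ζ b => HarmonicDisk.sub_eq_curvatureForm (deriv h ζ) (deriv g ζ)
    (deriv (deriv h) ζ) (deriv (deriv g) ζ) ζ b
  tfae_have 1 → 2 := fun hAK => ⟨hAK, fun a ha r hr =>
    HarmonicDisk.convex_image_ball_of_lt fun R hR =>
      hAK.2.2 a ha R ⟨hR.1, hR.2.trans_le hr.2⟩⟩
  tfae_have 2 → 1 := fun hAK => hAK.1
  tfae_have 1 → 3 := by
    rintro ⟨-, -, hconv⟩ ζ hζ b hb
    rw [← sub_nonneg, hE]
    have hm := HarmonicDisk.circleRatio_pos (mem_ball_zero_iff.mp hζ) b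
    have hJ := HarmonicDisk.sq_norm_sub_sq_norm_pos (hf.norm_deriv_lt hsp hζ)
    rcases eq_or_ne ((ζ - b) * (1 - ζ * conj b)) 0 with hd | hd
    · rw [hd, HarmonicDisk.curvatureForm_zero]
      nlinarith
    -- The Euclidean centre and radius of the circle through `ζ` with hyperbolic centre `b`.
    set e : ℂ := ((HarmonicDisk.circleRatio ζ b)⁻¹ : ℝ) * ((ζ - b) * (1 - ζ * conj b)) with he
    have har : ‖ζ - e‖ + ‖e‖ < 1 := HarmonicDisk.norm_center_add_radius_lt
      (mem_ball_zero_iff.mp hζ) (mem_ball_zero_iff.mp hb)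
    have he0 : 0 < ‖e‖ := norm_pos_iff.mpr
      (mul_ne_zero (Complex.ofReal_ne_zero.mpr (inv_pos.mpr hm).ne') hd)
    have hD := HarmonicDisk.closedBall_subset_unitBall har
    have hsmall : ∀ R ∈ Set.Ioc 0 ‖e‖, Convex ℝ (f '' Metric.ball (ζ - e) R) := fun R hR =>
      hconv (ζ - e) (hD (Metric.mem_closedBall_self he0.le)) R ⟨hR.1, by linarith [hR.2]⟩
    have hC := hf.curvatureForm_nonneg_of_convex_image hsp he0 hD (by rw [sub_sub_cancel])
      (hf.injOn_closedBall hsp he0.le hD fun R hR _ => hsmall R hR) (hsmall _ ⟨he0, le_rfl⟩)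
    rw [sub_sub_cancel, he, HarmonicDisk.curvatureForm_real_smul] at hC
    refine (mul_nonneg hm.le hC).trans_eq ?_
    field_simp
  tfae_have 3 → 1 := by
    intro h3
    have hpos := fun a ζ : ℂ => hf.curvatureForm_pos hsp
      (fun ζ hζ b hb => by
        rw [← hE, sub_nonneg]
        exact h3 ζ hζ b hb) (a := a) (ζ := ζ)
    refine ⟨⟨h, g, hf⟩, hf.locallyUnivalent hsp, fun a ha r hr => ?_⟩
    have har : ‖a‖ + r < 1 := by linarith [hr.2]
    have hD := HarmonicDisk.closedBall_subset_unitBall har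
    have hconv : ∀ R ∈ Set.Ioc 0 r, Set.InjOn f (Metric.ball a R) →
        Convex ℝ (f '' Metric.ball a R) := fun R hR hinj =>
      hf.convex_image_ball_of_curvatureForm_pos hsp
        (((Metric.ball_subset_ball hR.2).trans Metric.ball_subset_closedBall).trans hD)
        (fun ζ hζ => hpos a ζ (by linarith [mem_ball_iff_norm.mp hζ, hR.2])) hinj
    exact hconv r ⟨hr.1, le_rfl⟩
      ((hf.injOn_closedBall hsp hr.1.le hD hconv).mono Metric.ball_subset_closedBall)
  tfae_finish
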